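/- All manifolds, maps, metrics and vector fields are $C^\infty$, and manifolds are finite-dimensional, Hausdorff and without boundary. Let $(M, g_M, J)$ be an almost Hermitian manifold, i.e. $(M,g_M)$ is a Riemannian manifold and $J$ is a smooth field of endomorphisms of $TM$ with $J^2=-\mathrm{id}$ and $g_M(JX,JY)=g_M(X,Y)$. Let $(N,g_N)$ be a Riemannian manifold and let $F : M \to N$ be a Riemannian submersion, i.e. a surjective submersion whose differential $F_*$ preserves the lengths of the horizontal vectors, the vectors in $(\ker F_*)^\perp$. Suppose that $F$ is a *v-semi-slant submersion*: there are a distribution (a smooth subbundle of $TM$) $\mathcal D_1 \subset (\ker F_*)^\perp$ with $J(\mathcal D_1) = \mathcal D_1$ and a constant $\theta$ such that, with $\mathcal D_2$ denoting the orthogonal complement of $\mathcal D_1$ in $(\ker F_*)^\perp$, the angle between $JX$ and the subspace $(\mathcal D_2)_p$ equals $\theta$ for every $p \in M$ and every nonzero $X \in (\mathcal D_2)_p$. Let $\nabla$ be the Levi-Civita connection of $g_M$, let $\mathcal V$ and $\mathcal H$ be the orthogonal projections of $TM$ onto $\ker F_*$ and $(\ker F_*)^\perp$, let $P$ be the orthogonal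 projection onto $\mathcal D_1$, and put $CZ = \mathcal H(JZ)$. For vector fields $U, W$ on $M$ let $$\mathcal A_U W = \mathcal H \nabla_{\mathcal H U} (\mathcal V W) + \mathcal V \nabla_{\mathcal H U} (\mathcal H W)$$ be O'Neill's tensor. Let $\Gamma(\mathcal D_2)$ be the space of vector fields on $M$ with values in $\mathcal D_2$. **Theorem 3.4.** The slant distribution $\mathcal D_2$ is integrable (that is, $[X,Y] \in \Gamma(\mathcal D_2)$ for all $X,Y\in\Gamma(\mathcal D_2)$) if and only if $$\mathcal A_X Y = 0 \quad\text{and}\quad PC(\nabla_X Y - \nabla_Y X) = 0 \qquad \text{for all } X, Y \in \Gamma(\mathcal D_2).$$ -/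

import Mathlib

open Bundle Manifold VectorField
open scoped Manifold ContDiff Bundle Topology

noncomputable section

namespace RiemSubmersion

/-! ### The Levi-Civita connection of a Riemannian manifold -/

section LeviCivita

set_option linter.unusedSectionVars false

variable {E : Type*} [NormedAddCommGroup E] [NormedSpace ℝ E] [FiniteDimensional ℝ E]
  {M : Type*} [TopologicalSpace M] [ChartedSpace E M] [IsManifold 𝓘(ℝ, E) ∞ M]
  [RiemannianBundle (fun p : M => TangentSpace 𝓘(ℝ, E) p)]
  [IsContMDiffRiemannianBundle 𝓘(ℝ, E) ∞ E (fun p : M => TangentSpace 𝓘(ℝ, E) p)]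

/-- The function `g(X, Y)` on `M`, for vector fields `X` and `Y`. -/
def metricFun (X Y : Π p : M, TangentSpace 𝓘(ℝ, E) p) (p : M) : ℝ := inner ℝ (X p) (Y p)

/-- The right-hand side of the Koszul formula,
`X g(Y, Z) + Y g(Z, X) - Z g(X, Y) + g([X, Y], Z) - g([X, Z], Y) - g([Y, Z], X)`, at `p`. -/
def koszul (X Y Z : Π p : M, TangentSpace 𝓘(ℝ, E) p) (p : M) : ℝ :=
  mvfderiv 𝓘(ℝ, E) (metricFun Y Z) p (X p) + mvfderiv 𝓘(ℝ, E) (metricFun Z X) p (Y p)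
    - mvfderiv 𝓘(ℝ, E) (metricFun X Y) p (Z p)
    + inner ℝ (mlieBracket 𝓘(ℝ, E) X Y p) (Z p) - inner ℝ (mlieBracket 𝓘(ℝ, E) X Z p) (Y p)
    - inner ℝ (mlieBracket 𝓘(ℝ, E) Y Z p) (X p)

variable {X X' Y Y' Z Z' : Π p : M, TangentSpace 𝓘(ℝ, E) p} {p : M} {f : M → ℝ}

theorem mdiff_metricFun (hX : MDiffAt (T% X) p) (hY : MDiffAt (T% Y) p) :
    MDiffAt (metricFun X Y) p :=
  MDifferentiableAt.inner_bundle (E := fun p : M => TangentSpace 𝓘(ℝ, E) p) hX hY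

theorem metricFun_comm (X Y : Π p : M, TangentSpace 𝓘(ℝ, E) p) :
    metricFun X Y = metricFun Y X := by
  ext p; exact real_inner_comm _ _

theorem d_metricFun_add (hX : MDiffAt (T% X) p) (hX' : MDiffAt (T% X') p)
    (hY : MDiffAt (T% Y) p) :
    mvfderiv 𝓘(ℝ, E) (metricFun (X + X') Y) p =
      mvfderiv 𝓘(ℝ, E) (metricFun X Y) p + mvfderiv 𝓘(ℝ, E) (metricFun X' Y) p := by
  rw [← mvfderiv_add (mdiff_metricFun hX hY) (mdiff_metricFun hX' hY)]
  congr 1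
  ext q
  simp [metricFun, inner_add_left]

theorem d_metricFun_smul (hf : MDiffAt f p) (hX : MDiffAt (T% X) p) (hY : MDiffAt (T% Y) p) :
    mvfderiv 𝓘(ℝ, E) (metricFun (f • X) Y) p =
      f p • mvfderiv 𝓘(ℝ, E) (metricFun X Y) p + metricFun X Y p • mvfderiv 𝓘(ℝ, E) f p := by
  rw [← mvfderiv_mul hf (mdiff_metricFun hX hY)]
  congr 1
  ext q
  simp [metricFun, inner_smul_left]

theorem koszul_tensorial₁ (hY : MDiffAt (T% Y) p) (hZ : MDiffAt (T% Z) p) :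
    TensorialAt 𝓘(ℝ, E) E (fun X => koszul X Y Z p) p where
  smul {f X} hf hX := by
    have := FiniteDimensional.complete ℝ E
    simp only [koszul, metricFun_comm Z (f • X), metricFun_comm Z X,
      d_metricFun_smul hf hX hY, d_metricFun_smul hf hX hZ, mlieBracket_smul_left hf hX]
    simp [inner_add_left, inner_smul_left, inner_smul_right, metricFun]
    ring
  add {X X'} hX hX' := by
    have := FiniteDimensional.complete ℝ E
    simp only [koszul, metricFun_comm Z (X + X'), metricFun_comm Z X, metricFun_comm Z X',
      d_metricFun_add hX hX' hY, d_metricFun_add hX hX' hZ, mlieBracket_add_left hX hX']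
    simp [inner_add_left, inner_add_right]
    ring

theorem koszul_tensorial₃ (hX : MDiffAt (T% X) p) (hY : MDiffAt (T% Y) p) :
    TensorialAt 𝓘(ℝ, E) E (fun Z => koszul X Y Z p) p where
  smul {f Z} hf hZ := by
    have := FiniteDimensional.complete ℝ E
    simp only [koszul, metricFun_comm Y (f • Z), metricFun_comm Y Z,
      d_metricFun_smul hf hZ hY, d_metricFun_smul hf hZ hX, mlieBracket_smul_right hf hZ]
    simp [inner_add_left, inner_smul_left, inner_smul_right, metricFun,
      real_inner_comm (Z p)]
    ring
  add {Z Z'} hZ hZ' := by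
    have := FiniteDimensional.complete ℝ E
    simp only [koszul, metricFun_comm Y (Z + Z'), metricFun_comm Y Z, metricFun_comm Y Z',
      d_metricFun_add hZ hZ' hY, d_metricFun_add hZ hZ' hX, mlieBracket_add_right hZ hZ']
    simp [inner_add_left, inner_add_right]
    ring

instance (p : M) : FiniteDimensional ℝ (TangentSpace 𝓘(ℝ, E) p) :=
  inferInstanceAs (FiniteDimensional ℝ E)

instance (p : M) : CompleteSpace (TangentSpace 𝓘(ℝ, E) p) :=
  FiniteDimensional.complete ℝ (TangentSpace 𝓘(ℝ, E) p)

/-- For a vector field `Y` differentiable at `p`, the bilinear form on `T_p M` that sends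
`(X p, Z p)` to the right-hand side of the Koszul formula at `p`. -/
def koszulForm (Y : Π p : M, TangentSpace 𝓘(ℝ, E) p) (p : M) (hY : MDiffAt (T% Y) p) :
    TangentSpace 𝓘(ℝ, E) p →L[ℝ] TangentSpace 𝓘(ℝ, E) p →L[ℝ] ℝ :=
  TensorialAt.mkHom₂ (I := 𝓘(ℝ, E)) (F := E) (F' := E) (fun X Z => koszul X Y Z p) p
    (fun _ hZ => koszul_tensorial₁ hY hZ) (fun _ hX => koszul_tensorial₃ hX hY)

theorem koszulForm_apply (hX : MDiffAt (T% X) p) (hY : MDiffAt (T% Y) p)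
    (hZ : MDiffAt (T% Z) p) : koszulForm Y p hY (X p) (Z p) = koszul X Y Z p :=
  TensorialAt.mkHom₂_apply _ _ hX hZ

open Classical in
/-- The linear map `v ↦ ∇_v Y` on `T_p M`, where `2 g(∇_v Y, w)` is given by the Koszul formula
(and the value is `0` by convention if `Y` is not differentiable at `p`). -/
def leviCivitaFun (Y : Π p : M, TangentSpace 𝓘(ℝ, E) p) (p : M) :
    TangentSpace 𝓘(ℝ, E) p →L[ℝ] TangentSpace 𝓘(ℝ, E) p :=
  if hY : MDiffAt (T% Y) p then
    LinearMap.toContinuousLinearMap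
      { toFun := fun v =>
          (InnerProductSpace.toDual ℝ (TangentSpace 𝓘(ℝ, E) p)).symm
            ((1 / 2 : ℝ) • koszulForm Y p hY v)
        map_add' := fun v w => by simp
        map_smul' := fun c v => by simp [smul_comm c] }
  else 0

theorem inner_leviCivitaFun (hX : MDiffAt (T% X) p) (hY : MDiffAt (T% Y) p)
    (hZ : MDiffAt (T% Z) p) :
    inner ℝ (leviCivitaFun Y p (X p)) (Z p) = 1 / 2 * koszul X Y Z p := by
  rw [leviCivitaFun, dif_pos hY, ← koszulForm_apply hX hY hZ]
  rw [LinearMap.coe_toContinuousLinearMap', LinearMap.coe_mk, AddHom.coe_mk,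
    InnerProductSpace.toDual_symm_apply]
  rfl

theorem ext_inner_field {v w : TangentSpace 𝓘(ℝ, E) p}
    (h : ∀ Z : Π p : M, TangentSpace 𝓘(ℝ, E) p, MDiffAt (T% Z) p →
      inner ℝ v (Z p) = inner ℝ w (Z p)) : v = w := by
  refine ext_inner_right ℝ fun z => ?_
  simpa using h (FiberBundle.extend E z) (FiberBundle.mdifferentiableAt_extend ..)

theorem ext_field {A B : TangentSpace 𝓘(ℝ, E) p →L[ℝ] TangentSpace 𝓘(ℝ, E) p}
    (h : ∀ X : Π p : M, TangentSpace 𝓘(ℝ, E) p, MDiffAt (T% X) p → A (X p) = B (X p)) :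
    A = B := by
  ext v
  simpa using h (FiberBundle.extend E v) (FiberBundle.mdifferentiableAt_extend ..)

variable (E M) in
/-- The Levi-Civita connection of the Riemannian manifold `M`, given by the Koszul formula.
Argument order: `leviCivita E M Y p (X p)` is `(∇_X Y)(p)`. -/
def leviCivita : CovariantDerivative 𝓘(ℝ, E) E (fun p : M => TangentSpace 𝓘(ℝ, E) p) where
  toFun := leviCivitaFun
  isCovariantDerivativeOnUniv :=
    { add := by
        intro Y Y' p hY hY' _
        have := FiniteDimensional.complete ℝ E
        refine ext_field fun X hX => ext_inner_field fun Z hZ => ?_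
        have hYY' := mdifferentiableAt_add_section hY hY'
        rw [_root_.add_apply, inner_add_left, inner_leviCivitaFun hX hYY' hZ,
          inner_leviCivitaFun hX hY hZ, inner_leviCivitaFun hX hY' hZ]
        simp only [koszul, metricFun_comm X, d_metricFun_add hY hY' hX,
          d_metricFun_add hY hY' hZ, mlieBracket_add_left hY hY', mlieBracket_add_right hY hY']
        simp [inner_add_left, inner_add_right]
        ring
      leibniz := by
        intro Y f p hY hf _
        have := FiniteDimensional.complete ℝ E
        refine ext_field fun X hX => ext_inner_field fun Z hZ => ?_
        have hfY := hf.smul_section hY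
        rw [_root_.add_apply, inner_add_left, _root_.smul_apply,
          inner_smul_left, inner_leviCivitaFun hX hfY hZ, inner_leviCivitaFun hX hY hZ]
        simp only [koszul, metricFun_comm X, d_metricFun_smul hf hY hX,
          d_metricFun_smul hf hY hZ, mlieBracket_smul_left hf hY, mlieBracket_smul_right hf hY]
        simp [inner_add_left, inner_smul_left, inner_smul_right, metricFun]
        ring }

theorem inner_leviCivita (hX : MDiffAt (T% X) p) (hY : MDiffAt (T% Y) p)
    (hZ : MDiffAt (T% Z) p) :
    inner ℝ (leviCivita E M Y p (X p)) (Z p) = 1 / 2 * koszul X Y Z p :=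
  inner_leviCivitaFun hX hY hZ

/-- The Levi-Civita connection is torsion-free: `∇_X Y - ∇_Y X = [X, Y]`. -/
theorem leviCivita_torsion_free (hX : MDiffAt (T% X) p) (hY : MDiffAt (T% Y) p) :
    leviCivita E M Y p (X p) - leviCivita E M X p (Y p) = mlieBracket 𝓘(ℝ, E) X Y p := by
  refine ext_inner_field fun Z hZ => ?_
  rw [inner_sub_left, inner_leviCivita hX hY hZ, inner_leviCivita hY hX hZ]
  simp only [koszul, metricFun_comm Z, metricFun_comm Y X,
    mlieBracket_swap_apply (V := Y) (W := X), inner_neg_left]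
  ring

/-- The Levi-Civita connection is metric: `X g(Y, Z) = g(∇_X Y, Z) + g(Y, ∇_X Z)`. -/
theorem leviCivita_metric (hX : MDiffAt (T% X) p) (hY : MDiffAt (T% Y) p)
    (hZ : MDiffAt (T% Z) p) :
    mvfderiv 𝓘(ℝ, E) (metricFun Y Z) p (X p) =
      inner ℝ (leviCivita E M Y p (X p)) (Z p) + inner ℝ (Y p) (leviCivita E M Z p (X p)) := by
  rw [real_inner_comm _ (Y p), inner_leviCivita hX hY hZ, inner_leviCivita hX hZ hY]
  simp only [koszul, metricFun_comm Z, metricFun_comm Y X,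
    mlieBracket_swap_apply (V := Z) (W := Y), inner_neg_left]
  ring

end LeviCivita

/-! ### Vector fields and distributions -/

section Distributions

variable {E : Type*} [NormedAddCommGroup E] [NormedSpace ℝ E]
  {M : Type*} [TopologicalSpace M] [ChartedSpace E M] [IsManifold 𝓘(ℝ, E) ∞ M]

/-- The vector field `X` is of class `C^∞` on the set `s`. -/
def SmoothOn (X : Π p : M, TangentSpace 𝓘(ℝ, E) p) (s : Set M) : Prop :=
  ContMDiffOn 𝓘(ℝ, E) (𝓘(ℝ, E).prod 𝓘(ℝ, E)) ∞
    (fun p => TotalSpace.mk' E (E := fun p : M => TangentSpace 𝓘(ℝ, E) p) p (X p)) s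

/-- A family of subspaces `D p` of `T_p M` is a (smooth) distribution if it is locally spanned by
smooth linearly independent vector fields, i.e. if it is a smooth subbundle of `TM`. -/
def IsDistribution (D : Π p : M, Submodule ℝ (TangentSpace 𝓘(ℝ, E) p)) : Prop :=
  ∀ p : M, ∃ U : Set M, IsOpen U ∧ p ∈ U ∧
    ∃ (k : ℕ) (X : Fin k → Π q : M, TangentSpace 𝓘(ℝ, E) q),
      (∀ i, SmoothOn (X i) U) ∧
      ∀ q ∈ U, LinearIndependent ℝ (fun i => X i q) ∧
        Submodule.span ℝ (Set.range fun i => X i q) = D q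

/-- `IsSection D X` means `X ∈ Γ(D)`: `X` is a smooth vector field on `M` with values in `D`. -/
def IsSection (D : Π p : M, Submodule ℝ (TangentSpace 𝓘(ℝ, E) p))
    (X : Π p : M, TangentSpace 𝓘(ℝ, E) p) : Prop :=
  SmoothOn X Set.univ ∧ ∀ p, X p ∈ D p

/-- `D` is integrable: `[X, Y] ∈ Γ(D)` for all `X, Y ∈ Γ(D)`. (The bracket of smooth vector
fields is smooth, so that only its values have to be mentioned.) -/
def IsIntegrable (D : Π p : M, Submodule ℝ (TangentSpace 𝓘(ℝ, E) p)) : Prop :=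
  ∀ X Y : Π p : M, TangentSpace 𝓘(ℝ, E) p, IsSection D X → IsSection D Y →
    ∀ p, mlieBracket 𝓘(ℝ, E) X Y p ∈ D p

end Distributions

/-! ### Almost Hermitian manifolds -/

section AlmostHermitian

variable {E : Type*} [NormedAddCommGroup E] [NormedSpace ℝ E]
  {M : Type*} [TopologicalSpace M] [ChartedSpace E M] [IsManifold 𝓘(ℝ, E) ∞ M]
  [RiemannianBundle (fun p : M => TangentSpace 𝓘(ℝ, E) p)]

/-- `J` makes the Riemannian manifold `M` an almost Hermitian manifold: it is a smooth field of
endomorphisms of the tangent spaces with `J² = -id` and `g(J v, J w) = g(v, w)`. -/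
structure IsAlmostHermitian
    (J : Π p : M, TangentSpace 𝓘(ℝ, E) p →L[ℝ] TangentSpace 𝓘(ℝ, E) p) : Prop where
  smooth : ContMDiff 𝓘(ℝ, E) (𝓘(ℝ, E).prod 𝓘(ℝ, E →L[ℝ] E)) ∞
    (fun p => TotalSpace.mk' (E →L[ℝ] E)
      (E := fun p : M => TangentSpace 𝓘(ℝ, E) p →L[ℝ] TangentSpace 𝓘(ℝ, E) p) p (J p))
  sq_eq_neg : ∀ (p : M) (v : TangentSpace 𝓘(ℝ, E) p), J p (J p v) = -v
  inner_eq : ∀ (p : M) (v w : TangentSpace 𝓘(ℝ, E) p), inner ℝ (J p v) (J p w) = inner ℝ v w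

end AlmostHermitian

/-! ### Riemannian submersions -/

section Submersions

variable (E : Type*) [NormedAddCommGroup E] [NormedSpace ℝ E] [FiniteDimensional ℝ E]
  {M : Type*} [TopologicalSpace M] [ChartedSpace E M] [IsManifold 𝓘(ℝ, E) ∞ M]
  [RiemannianBundle (fun p : M => TangentSpace 𝓘(ℝ, E) p)]
  (E' : Type*) [NormedAddCommGroup E'] [NormedSpace ℝ E']
  {N : Type*} [TopologicalSpace N] [ChartedSpace E' N]

/-- The vertical space `ker (F_*)_p`. -/
def vertical (F : M → N) (p : M) : Submodule ℝ (TangentSpace 𝓘(ℝ, E) p) :=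
  LinearMap.ker (mfderiv 𝓘(ℝ, E) 𝓘(ℝ, E') F p).toLinearMap

/-- The horizontal space `(ker (F_*)_p)ᗮ`. -/
def horizontal (F : M → N) (p : M) : Submodule ℝ (TangentSpace 𝓘(ℝ, E) p) :=
  (vertical E E' F p)ᗮ

/-- The orthogonal projection `𝒱` of `T_p M` onto the vertical space. -/
def projV (F : M → N) (p : M) : TangentSpace 𝓘(ℝ, E) p →L[ℝ] TangentSpace 𝓘(ℝ, E) p :=
  (vertical E E' F p).starProjection

/-- The orthogonal projection `ℋ` of `T_p M` onto the horizontal space. -/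
def projH (F : M → N) (p : M) : TangentSpace 𝓘(ℝ, E) p →L[ℝ] TangentSpace 𝓘(ℝ, E) p :=
  (horizontal E E' F p).starProjection

/-- `F : M → N` is a Riemannian submersion of `M` onto `N`: a surjective `C^∞` map with surjective
differentials that preserve the lengths of horizontal vectors. -/
structure IsRiemannianSubmersion [RiemannianBundle (fun p : N => TangentSpace 𝓘(ℝ, E') p)]
    (F : M → N) : Prop where
  surjective : Function.Surjective F
  smooth : ContMDiff 𝓘(ℝ, E) 𝓘(ℝ, E') ∞ F
  surjective_mfderiv : ∀ p : M, Function.Surjective (mfderiv 𝓘(ℝ, E) 𝓘(ℝ, E') F p)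
  norm_mfderiv : ∀ (p : M), ∀ v ∈ horizontal E E' F p, ‖mfderiv 𝓘(ℝ, E) 𝓘(ℝ, E') F p v‖ = ‖v‖

/-- O'Neill's tensor `𝒜_X Y = ℋ ∇_{ℋ X} (𝒱 Y) + 𝒱 ∇_{ℋ X} (ℋ Y)`. -/
def oneillA [IsContMDiffRiemannianBundle 𝓘(ℝ, E) ∞ E (fun p : M => TangentSpace 𝓘(ℝ, E) p)]
    (F : M → N) (X Y : Π p : M, TangentSpace 𝓘(ℝ, E) p) (p : M) : TangentSpace 𝓘(ℝ, E) p :=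
  projH E E' F p (leviCivita E M (fun q => projV E E' F q (Y q)) p (projH E E' F p (X p))) +
    projV E E' F p (leviCivita E M (fun q => projH E E' F q (Y q)) p (projH E E' F p (X p)))

/-! ### v-semi-slant submersions -/

/-- `C Z = ℋ (J Z)`, so that `J Z = B Z + C Z` for horizontal `Z`, with `B Z` vertical and `C Z`
horizontal. -/
def opC (J : Π p : M, TangentSpace 𝓘(ℝ, E) p →L[ℝ] TangentSpace 𝓘(ℝ, E) p) (F : M → N) (p : M)
    (Z : TangentSpace 𝓘(ℝ, E) p) : TangentSpace 𝓘(ℝ, E) p :=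
  projH E E' F p (J p Z)

/-- The orthogonal complement `D₂` of `D₁` in the horizontal distribution. -/
def slantDistribution (F : M → N) (D₁ : Π p : M, Submodule ℝ (TangentSpace 𝓘(ℝ, E) p)) (p : M) :
    Submodule ℝ (TangentSpace 𝓘(ℝ, E) p) :=
  (D₁ p)ᗮ ⊓ horizontal E E' F p

/-- The orthogonal projection of `T_p M` onto `D p`. On horizontal vectors, and for `D = D₁`, this
is the map `P` of the decomposition `X = P X + Q X` with `P X ∈ D₁` and `Q X ∈ D₂`. -/
def projD (D : Π p : M, Submodule ℝ (TangentSpace 𝓘(ℝ, E) p)) (p : M) :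
    TangentSpace 𝓘(ℝ, E) p →L[ℝ] TangentSpace 𝓘(ℝ, E) p :=
  (D p).starProjection

/-- The angle in `[0, π/2]` between a nonzero vector `v` and a subspace `W`. -/
def angleSubspace {V : Type*} [NormedAddCommGroup V] [InnerProductSpace ℝ V] (v : V)
    (W : Submodule ℝ V) [W.HasOrthogonalProjection] : ℝ :=
  Real.arccos (‖W.starProjection v‖ / ‖v‖)

/-- `F` is a v-semi-slant submersion of the almost Hermitian manifold `(M, g, J)` onto `N`, with
complex distribution `D₁`, slant distribution `slantDistribution E E' F D₁` and v-semi-slant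
angle `θ`. -/
structure IsVSemiSlantSubmersion [RiemannianBundle (fun p : N => TangentSpace 𝓘(ℝ, E') p)]
    (J : Π p : M, TangentSpace 𝓘(ℝ, E) p →L[ℝ] TangentSpace 𝓘(ℝ, E) p) (F : M → N)
    (D₁ : Π p : M, Submodule ℝ (TangentSpace 𝓘(ℝ, E) p)) (θ : ℝ) : Prop
    extends IsRiemannianSubmersion E E' F where
  isDistribution : IsDistribution D₁
  le_horizontal : ∀ p, D₁ p ≤ horizontal E E' F p
  map_eq : ∀ p, (D₁ p).map (J p).toLinearMap = D₁ p
  angle_eq : ∀ (p : M), ∀ X ∈ slantDistribution E E' F D₁ p, X ≠ 0 →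
    angleSubspace (J p X) (slantDistribution E E' F D₁ p) = θ

end Submersions

end RiemSubmersion

end

namespace RiemSubmersion

/-! The equivalence holds for each pair X, Y in Γ(D₂) and at each point. A vector lies in D₂ exactly
when it is orthogonal to D₁ and has no vertical component; for v = [X, Y] the two right-hand
conditions say precisely this.

Since ∇ is torsion-free, the second condition reads PC[X, Y] = 0. As J is an isometry with J(D₁) =
D₁ and D₁ is horizontal, PCv = 0 means v ⊥ D₁ (`projD_opC_eq_zero_iff`). The first is verticality:
O'Neill's identity 𝒜_X Y = ½ 𝒱[X, Y] for horizontal fields (`IsRiemannianSubmersion.oneillA_eq`).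

O'Neill's identity is proved without basic fields. In the Koszul formula for horizontal X, Y and a
field Z vertical at p, every inner product with a horizontal entry may be taken in F^*g_N. Near p
this form is ∑ df_i df_j G_ij, with f_i and G_ij pulled back from N, so that df_i and dG_ij kill
Z(p). Expanding, and writing brackets as commutators of derivations (`mvfderiv_mlieBracket`),
everything cancels except g([X, Y], Z) (`IsRiemannianSubmersion.koszul_eq`). -/

theorem eventually_mdifferentiableAt {E E' M N : Type*} [NormedAddCommGroup E] [NormedSpace ℝ E]
    [TopologicalSpace M] [ChartedSpace E M] [IsManifold 𝓘(ℝ, E) ∞ M]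
    [NormedAddCommGroup E'] [NormedSpace ℝ E']
    [TopologicalSpace N] [ChartedSpace E' N] [IsManifold 𝓘(ℝ, E') ∞ N]
    {F : M → N} {p : M} (hF : CMDiffAt 2 F p) : ∀ᶠ q in 𝓝 p, MDiffAt F q :=
  ((contMDiffAt_iff_contMDiffAt_nhds (by norm_num)).1 hF).mono
    fun _ hq => hq.mdifferentiableAt (by norm_num)

/-! ### Vector fields as derivations, and their commutators. -/

section DirectionalDerivative

variable {E : Type*} [NormedAddCommGroup E] [NormedSpace ℝ E]
  {M : Type*} [TopologicalSpace M] [ChartedSpace E M] [IsManifold 𝓘(ℝ, E) ∞ M]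
  {V : Type*} [NormedAddCommGroup V] [NormedSpace ℝ V]
  {X Y : Π p : M, TangentSpace 𝓘(ℝ, E) p} {f : M → V} {p : M}

/-- The derivative of a smooth function along a differentiable vector field is differentiable. -/
theorem mdifferentiableAt_mvfderiv_apply (hf : CMDiffAt 2 f p) (hX : MDiffAt (T% X) p) :
    MDiffAt (fun q => mvfderiv 𝓘(ℝ, E) f q (X q)) p := by
  have h1 := (hf.mfderiv_const (m := 1) (by norm_num)).mdifferentiableAt one_ne_zero
  have h2 := MDifferentiableAt.clm_apply_of_inCoordinates h1 hX
    (hf.mdifferentiableAt (by norm_num))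
  exact ((contMDiff_snd_tangentBundle_modelSpace V 𝓘(ℝ, V) (n := 1)).contMDiffAt.mdifferentiableAt
    one_ne_zero).comp p h2

/-- The coordinate expression of the vector field `X` in the chart at `p`. -/
noncomputable def chartField (p : M) (X : Π p : M, TangentSpace 𝓘(ℝ, E) p) : E → E :=
  mpullbackWithin 𝓘(ℝ, E) 𝓘(ℝ, E) (extChartAt 𝓘(ℝ, E) p).symm X (Set.range 𝓘(ℝ, E))

/-- In the chart at `p`, the function `X f` becomes the derivative of the coordinate expression
of `f` along the coordinate expression of `X`. -/
theorem fderiv_comp_extChartAt_symm_chartField {y : E} (hy : y ∈ (extChartAt 𝓘(ℝ, E) p).target)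
    (hf : MDiffAt f ((extChartAt 𝓘(ℝ, E) p).symm y)) :
    fderiv ℝ (f ∘ (extChartAt 𝓘(ℝ, E) p).symm) y
        (chartField p X y) =
      mvfderiv 𝓘(ℝ, E) f ((extChartAt 𝓘(ℝ, E) p).symm y)
        (X ((extChartAt 𝓘(ℝ, E) p).symm y)) := by
  have hinv := isInvertible_mfderivWithin_extChartAt_symm (I := 𝓘(ℝ, E)) hy
  have hd : MDifferentiableAt 𝓘(ℝ, E) 𝓘(ℝ, E) (extChartAt 𝓘(ℝ, E) p).symm y := by
    have := (contMDiffWithinAt_extChartAt_symm_range (I := 𝓘(ℝ, E)) (n := 1) p hy)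
    rw [modelWithCornersSelf_coe, Set.range_id, contMDiffWithinAt_univ] at this
    exact this.mdifferentiableAt one_ne_zero
  rw [chartField, mpullbackWithin_apply, ← mfderiv_eq_fderiv, mfderiv_comp y hf hd]
  simp only [modelWithCornersSelf_coe, Set.range_id, mfderivWithin_univ] at hinv ⊢
  change (mfderiv 𝓘(ℝ, E) 𝓘(ℝ, V) f _) ((mfderiv 𝓘(ℝ, E) 𝓘(ℝ, E) (extChartAt 𝓘(ℝ, E) p).symm y)
    ((mfderiv 𝓘(ℝ, E) 𝓘(ℝ, E) (extChartAt 𝓘(ℝ, E) p).symm y).inverse _)) = _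
  rw [hinv.self_apply_inverse]
  rfl

theorem mvfderiv_apply_eq_fderiv_comp_extChartAt_symm (hf : MDiffAt f p) :
    mvfderiv 𝓘(ℝ, E) f p (X p) =
      fderiv ℝ (f ∘ (extChartAt 𝓘(ℝ, E) p).symm) (extChartAt 𝓘(ℝ, E) p p)
        (chartField p X
          (extChartAt 𝓘(ℝ, E) p p)) := by
  rw [fderiv_comp_extChartAt_symm_chartField (mem_extChartAt_target p)
    (by rwa [extChartAt_to_inv]), extChartAt_to_inv]

/-- Differentiation along `[X, Y]` is the commutator of the differentiations along `X` and `Y`. -/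
theorem mvfderiv_mlieBracket [CompleteSpace E] (hf : CMDiffAt 2 f p) (hX : MDiffAt (T% X) p)
    (hY : MDiffAt (T% Y) p) :
    mvfderiv 𝓘(ℝ, E) f p (mlieBracket 𝓘(ℝ, E) X Y p) =
      mvfderiv 𝓘(ℝ, E) (fun q => mvfderiv 𝓘(ℝ, E) f q (Y q)) p (X p) -
        mvfderiv 𝓘(ℝ, E) (fun q => mvfderiv 𝓘(ℝ, E) f q (X q)) p (Y p) := by
  have hid : Set.range 𝓘(ℝ, E) = Set.univ := by simp
  have hfev := eventually_mdifferentiableAt hf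
  have hsymm : ContMDiffAt 𝓘(ℝ, E) 𝓘(ℝ, E) 2 (extChartAt 𝓘(ℝ, E) p).symm
      (extChartAt 𝓘(ℝ, E) p p) := by
    rw [← contMDiffWithinAt_univ, ← hid]
    exact contMDiffWithinAt_extChartAt_symm_range p (mem_extChartAt_target p)
  have hf' : ContDiffAt ℝ 2 (f ∘ (extChartAt 𝓘(ℝ, E) p).symm) (extChartAt 𝓘(ℝ, E) p p) := by
    rw [← contMDiffAt_iff_contDiffAt]
    exact ContMDiffAt.comp _ (by rwa [extChartAt_to_inv]) hsymm
  have hbr : mlieBracket 𝓘(ℝ, E) X Y p = (mfderiv 𝓘(ℝ, E) 𝓘(ℝ, E) (extChartAt 𝓘(ℝ, E) p) p).inverse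
      (lieBracket (E := E) ℝ (chartField p X) (chartField p Y) (extChartAt 𝓘(ℝ, E) p p)) := by
    rw [← mlieBracketWithin_univ, mlieBracketWithin_apply, Set.preimage_univ, Set.univ_inter,
      ← lieBracketWithin_univ, ← hid]
    rfl
  have hdiff : ∀ {Z : Π p : M, TangentSpace 𝓘(ℝ, E) p}, MDiffAt (T% Z) p → DifferentiableAt ℝ
      (chartField p Z) (extChartAt 𝓘(ℝ, E) p p) := by
    intro Z hZ
    have := (mdifferentiableWithinAt_univ.2
      hZ).differentiableWithinAt_mpullbackWithin_vectorField
    rw [Set.preimage_univ, Set.univ_inter] at this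
    rw [← differentiableWithinAt_univ, ← hid]
    exact this
  -- Near p, f is its coordinate expression composed with the chart; the chain rule splits the
  -- differential accordingly.
  have hchart : mfderiv 𝓘(ℝ, E) 𝓘(ℝ, V) f p =
      (mfderiv 𝓘(ℝ, E) 𝓘(ℝ, V) (f ∘ (extChartAt 𝓘(ℝ, E) p).symm) (extChartAt 𝓘(ℝ, E) p p)).comp
        (mfderiv 𝓘(ℝ, E) 𝓘(ℝ, E) (extChartAt 𝓘(ℝ, E) p) p) := by
    rw [← mfderiv_comp p (contMDiffAt_iff_contDiffAt.2 hf' |>.mdifferentiableAt (by norm_num))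
      (mdifferentiableAt_extChartAt (mem_chart_source E p))]
    refine Filter.EventuallyEq.mfderiv_eq ?_
    filter_upwards [extChartAt_source_mem_nhds (I := 𝓘(ℝ, E)) p] with q hq
    rw [Function.comp_apply, Function.comp_apply, (extChartAt 𝓘(ℝ, E) p).left_inv hq]
  have hiter : ∀ {Z : Π p : M, TangentSpace 𝓘(ℝ, E) p},
      (fun q => mvfderiv 𝓘(ℝ, E) f q (Z q)) ∘ (extChartAt 𝓘(ℝ, E) p).symm
        =ᶠ[𝓝 (extChartAt 𝓘(ℝ, E) p p)] fun y => fderiv ℝ (f ∘ (extChartAt 𝓘(ℝ, E) p).symm) y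
        (chartField p Z y) := by
    intro Z
    have hc := hsymm.continuousAt
    rw [ContinuousAt, extChartAt_to_inv] at hc
    filter_upwards [extChartAt_target_mem_nhds (I := 𝓘(ℝ, E)) p, hc.eventually hfev]
      with y hy hfy
    exact (fderiv_comp_extChartAt_symm_chartField hy hfy).symm
  -- Both iterated derivatives now live in the chart, where the claim is the commutator formula in a
  -- normed space, resting on the symmetry of the second derivative.
  rw [mvfderiv_apply_eq_fderiv_comp_extChartAt_symm (mdifferentiableAt_mvfderiv_apply hf hY),
    mvfderiv_apply_eq_fderiv_comp_extChartAt_symm (mdifferentiableAt_mvfderiv_apply hf hX),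
    hiter.fderiv_eq, hiter.fderiv_eq,
    ← fderiv_apply_lieBracket hf' (by simp) (hdiff hY) (hdiff hX), hbr]
  change mfderiv 𝓘(ℝ, E) 𝓘(ℝ, V) f p _ = _
  rw [hchart, mfderiv_eq_fderiv]
  exact congrArg (fderiv ℝ (f ∘ (extChartAt 𝓘(ℝ, E) p).symm) (extChartAt 𝓘(ℝ, E) p p))
    ((isInvertible_mfderiv_extChartAt (mem_extChartAt_source p)).self_apply_inverse _)

end DirectionalDerivative

/-! ### Coordinates and dual frames. -/

section Coordinates

variable {E' : Type*} [NormedAddCommGroup E'] [NormedSpace ℝ E'] [FiniteDimensional ℝ E']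
  {N : Type*} [TopologicalSpace N] [ChartedSpace E' N] [IsManifold 𝓘(ℝ, E') ∞ N]

/-- Local coordinates around a point, together with the frame dual to their differentials. -/
theorem exists_coordinates_dual_frame (y : N) :
    ∃ (n : ℕ) (x : Fin n → N → ℝ) (e : Fin n → Π z : N, TangentSpace 𝓘(ℝ, E') z),
      (∀ i, CMDiffAt 2 (x i) y) ∧ (∀ i, MDiffAt (T% (e i)) y) ∧
      ∀ᶠ z in 𝓝 y, (∀ i, MDiffAt (x i) z) ∧ ∀ w : TangentSpace 𝓘(ℝ, E') z,
        w = ∑ i, mvfderiv 𝓘(ℝ, E') (x i) z w • e i z := by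
  let b := Module.finBasis ℝ E'
  let t := trivializationAt E' (TangentSpace 𝓘(ℝ, E') : N → Type _) y
  have hy : y ∈ t.baseSet := FiberBundle.mem_baseSet_trivializationAt' y
  have hx : ∀ i, ∀ z ∈ (chartAt E' y).source,
      CMDiffAt 2 (LinearMap.toContinuousLinearMap (b.coord i) ∘ extChartAt 𝓘(ℝ, E') y) z :=
    fun i z hz => (ContinuousLinearMap.contMDiff _).contMDiffAt.comp z
      (contMDiffAt_extChartAt' hz)
  refine ⟨_, fun i => LinearMap.toContinuousLinearMap (b.coord i) ∘ extChartAt 𝓘(ℝ, E') y,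
    t.localFrame b, fun i => hx i y (mem_chart_source E' y), fun i => ?_, ?_⟩
  · exact (contMDiffAt_localFrame_of_mem 1 t b i hy).mdifferentiableAt one_ne_zero
  · filter_upwards [t.open_baseSet.mem_nhds hy] with z hz
    have hz' : z ∈ (chartAt E' y).source := hz
    refine ⟨fun i => (hx i z hz').mdifferentiableAt (by norm_num), fun w => ?_⟩
    -- The frame expansion is stated for sections, so w is extended to one. Its coefficients are the
    -- basis coordinates of the trivialised w, and the trivialisation is the differential of the
    -- chart.
    have key := t.eq_sum_localFrameCoeff_smul (I := 𝓘(ℝ, E')) (b := b)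
      (s := FiberBundle.extend E' w) hz
    rw [FiberBundle.extend_apply_self] at key
    refine key.trans (Finset.sum_congr rfl fun i _ => ?_)
    congr 1
    have h1 := t.localFrameCoeff_eq_coeff (I := 𝓘(ℝ, E')) (b := b)
      (s := FiberBundle.extend E' w) hz (i := i)
    rw [FiberBundle.extend_apply_self] at h1
    rw [h1, mvfderiv_comp z (ContinuousLinearMap.contMDiff _ |>.mdifferentiable one_ne_zero _)
      (mdifferentiableAt_extChartAt hz')]
    have h2 := congrArg (fun A => b.coord i (A w))
      (TangentBundle.continuousLinearMapAt_trivializationAt (I := 𝓘(ℝ, E')) hz')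
    have h3 : t.continuousLinearMapAt ℝ z w = (t ⟨z, w⟩).2 := by
      rw [Trivialization.continuousLinearMapAt_apply, t.coe_linearMapAt_of_mem hz]
    beta_reduce
    rw [FiberBundle.extend_apply_self, ← h3]
    refine h2.trans ?_
    have h4 : mfderiv 𝓘(ℝ, E') 𝓘(ℝ, ℝ) (LinearMap.toContinuousLinearMap (b.coord i))
        (extChartAt 𝓘(ℝ, E') y z) = LinearMap.toContinuousLinearMap (b.coord i) := by
      rw [mfderiv_eq_fderiv, ContinuousLinearMap.fderiv]
    exact (DFunLike.congr_fun h4 _).symm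

end Coordinates

/-! ### The pulled-back metric in coordinates of the target. -/

section Pullback

variable {E : Type*} [NormedAddCommGroup E] [NormedSpace ℝ E]
  {M : Type*} [TopologicalSpace M] [ChartedSpace E M] [IsManifold 𝓘(ℝ, E) ∞ M]
  {E' : Type*} [NormedAddCommGroup E'] [NormedSpace ℝ E'] [FiniteDimensional ℝ E']
  {N : Type*} [TopologicalSpace N] [ChartedSpace E' N] [IsManifold 𝓘(ℝ, E') ∞ N]
  [RiemannianBundle (fun p : N => TangentSpace 𝓘(ℝ, E') p)]
  [IsContMDiffRiemannianBundle 𝓘(ℝ, E') ∞ E' (fun p : N => TangentSpace 𝓘(ℝ, E') p)]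

/-- The pullback of a Riemannian metric, in terms of local coordinates on the target. -/
theorem exists_pullback_metric_coordinates {F : M → N} {p : M} (hF : CMDiffAt 2 F p) :
    ∃ (n : ℕ) (f : Fin n → M → ℝ) (G : Fin n → Fin n → M → ℝ),
      (∀ i, CMDiffAt 2 (f i) p) ∧ (∀ i j, MDiffAt (G i j) p) ∧ (∀ i j, G i j = G j i) ∧
      (∀ v : TangentSpace 𝓘(ℝ, E) p, mfderiv 𝓘(ℝ, E) 𝓘(ℝ, E') F p v = 0 →
        (∀ i, mvfderiv 𝓘(ℝ, E) (f i) p v = 0) ∧ ∀ i j, mvfderiv 𝓘(ℝ, E) (G i j) p v = 0) ∧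
      ∀ᶠ q in 𝓝 p, ∀ v w : TangentSpace 𝓘(ℝ, E) q,
        inner ℝ (mfderiv 𝓘(ℝ, E) 𝓘(ℝ, E') F q v) (mfderiv 𝓘(ℝ, E) 𝓘(ℝ, E') F q w) =
          ∑ i, ∑ j, mvfderiv 𝓘(ℝ, E) (f i) q v * mvfderiv 𝓘(ℝ, E) (f j) q w * G i j q := by
  obtain ⟨n, x, e, hx, he, hev⟩ := exists_coordinates_dual_frame (E' := E') (F p)
  have hFd : MDiffAt F p := hF.mdifferentiableAt (by norm_num)
  have hFev := eventually_mdifferentiableAt hF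
  have hG : ∀ i j, MDiffAt (fun z => inner ℝ (e i z) (e j z)) (F p) := fun i j =>
    MDifferentiableAt.inner_bundle (E := fun p : N => TangentSpace 𝓘(ℝ, E') p) (he i) (he j)
  refine ⟨n, fun i => x i ∘ F, fun i j => (fun z => inner ℝ (e i z) (e j z)) ∘ F,
    fun i => (hx i).comp p hF, fun i j => (hG i j).comp p hFd,
    fun i j => funext fun q => real_inner_comm _ _, fun v hv => ⟨fun i => ?_, fun i j => ?_⟩, ?_⟩
  -- Both families of functions factor through F, so their differentials vanish on the kernel of dF.
  · rw [mvfderiv_comp_apply p ((hx i).mdifferentiableAt (by norm_num)) hFd, hv, map_zero]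
  · rw [mvfderiv_comp_apply p (hG i j) hFd, hv, map_zero]
  · filter_upwards [hF.continuousAt.eventually hev, hFev] with q ⟨hxq, hq⟩ hFq v w
    have hd : ∀ i (u : TangentSpace 𝓘(ℝ, E) q), mvfderiv 𝓘(ℝ, E) (x i ∘ F) q u =
        mvfderiv 𝓘(ℝ, E') (x i) (F q) (mfderiv 𝓘(ℝ, E) 𝓘(ℝ, E') F q u) :=
      fun i u => mvfderiv_comp_apply q (hxq i) hFq u
    conv_lhs => rw [hq (mfderiv 𝓘(ℝ, E) 𝓘(ℝ, E') F q v), hq (mfderiv 𝓘(ℝ, E) 𝓘(ℝ, E') F q w)]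
    rw [sum_inner]
    refine Finset.sum_congr rfl fun i _ => ?_
    rw [inner_sum]
    refine Finset.sum_congr rfl fun j _ => ?_
    rw [inner_smul_left, inner_smul_right, hd, hd, mul_assoc]
    rfl

end Pullback

/-! ### The Leibniz rule for coordinate expressions of a metric. -/

section Derivation

variable {E : Type*} [NormedAddCommGroup E] [NormedSpace ℝ E]
  {M : Type*} [TopologicalSpace M] [ChartedSpace E M]

theorem mvfderiv_sum_apply {ι : Type} {s : Finset ι} {g : ι → M → ℝ} {p : M}
    (hg : ∀ i ∈ s, MDiffAt (g i) p) (v : TangentSpace 𝓘(ℝ, E) p) :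
    mvfderiv 𝓘(ℝ, E) (fun q => ∑ i ∈ s, g i q) p v = ∑ i ∈ s, mvfderiv 𝓘(ℝ, E) (g i) p v := by
  classical
  induction s using Finset.induction_on with
  | empty => simp [mvfderiv_const]
  | insert a s ha ih =>
    have hs : ∀ i ∈ s, MDiffAt (g i) p := fun i hi => hg i (Finset.mem_insert_of_mem hi)
    have hsum : MDiffAt (fun q => ∑ i ∈ s, g i q) p := by
      have := MDifferentiableAt.sum (f := g) hs
      rwa [Finset.sum_fn] at this
    simp only [Finset.sum_insert ha]
    rw [mvfderiv_fun_add (hg a (Finset.mem_insert_self a s)) hsum, _root_.add_apply, ih hs]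

/-- Differentiates g(U, W) once it is written in coordinates. Agreement near p is all that is
available, and all that a derivative at p needs. -/
theorem mvfderiv_sum_sum_mul_apply {ι : Type} [Fintype ι] {h : M → ℝ} {x y : ι → M → ℝ}
    {G : ι → ι → M → ℝ} {p : M} (hx : ∀ i, MDiffAt (x i) p) (hy : ∀ i, MDiffAt (y i) p)
    (hG : ∀ i j, MDiffAt (G i j) p)
    (hh : h =ᶠ[𝓝 p] fun q => ∑ i, ∑ j, x i q * y j q * G i j q)
    (v : TangentSpace 𝓘(ℝ, E) p) :
    mvfderiv 𝓘(ℝ, E) h p v = ∑ i, ∑ j,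
      (mvfderiv 𝓘(ℝ, E) (x i) p v * y j p * G i j p +
        x i p * mvfderiv 𝓘(ℝ, E) (y j) p v * G i j p +
        x i p * y j p * mvfderiv 𝓘(ℝ, E) (G i j) p v) := by
  have hxy : ∀ i j, MDiffAt (fun q => x i q * y j q) p := fun i j => (hx i).mul (hy j)
  have hterm : ∀ i j, MDiffAt (fun q => x i q * y j q * G i j q) p :=
    fun i j => (hxy i j).mul (hG i j)
  have hrow : ∀ i, MDiffAt (fun q => ∑ j, x i q * y j q * G i j q) p := by
    intro i
    have := MDifferentiableAt.sum (t := Finset.univ) (f := fun j q => x i q * y j q * G i j q) fun j _ => hterm i j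
    rwa [Finset.sum_fn] at this
  have hmf : mvfderiv 𝓘(ℝ, E) h p =
      mvfderiv 𝓘(ℝ, E) (fun q => ∑ i, ∑ j, x i q * y j q * G i j q) p := by
    ext w
    exact DFunLike.congr_fun hh.mfderiv_eq w
  rw [hmf, mvfderiv_sum_apply fun i _ => hrow i]
  refine Finset.sum_congr rfl fun i _ => ?_
  rw [mvfderiv_sum_apply fun j _ => hterm i j]
  refine Finset.sum_congr rfl fun j _ => ?_
  rw [mvfderiv_fun_mul (hxy i j) (hG i j), mvfderiv_fun_mul (hx i) (hy j)]
  simp only [_root_.add_apply, _root_.smul_apply, smul_eq_mul]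
  ring

end Derivation

/-! ### O'Neill's identity for horizontal fields. -/

section ONeill

variable {E : Type*} [NormedAddCommGroup E] [NormedSpace ℝ E] [FiniteDimensional ℝ E]
  {M : Type*} [TopologicalSpace M] [ChartedSpace E M]
  [RiemannianBundle (fun p : M => TangentSpace 𝓘(ℝ, E) p)]
  {E' : Type*} [NormedAddCommGroup E'] [NormedSpace ℝ E']
  {N : Type*} [TopologicalSpace N] [ChartedSpace E' N]
  [RiemannianBundle (fun p : N => TangentSpace 𝓘(ℝ, E') p)]
  {F : M → N} {p : M}

/-- The differential of a Riemannian submersion preserves inner products with horizontal vectors. -/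
theorem IsRiemannianSubmersion.inner_mfderiv (hF : IsRiemannianSubmersion E E' F)
    {v : TangentSpace 𝓘(ℝ, E) p} (hv : v ∈ horizontal E E' F p) (w : TangentSpace 𝓘(ℝ, E) p) :
    inner ℝ (mfderiv 𝓘(ℝ, E) 𝓘(ℝ, E') F p v) (mfderiv 𝓘(ℝ, E) 𝓘(ℝ, E') F p w) = inner ℝ v w := by
  have hhor : ∀ u ∈ horizontal E E' F p,
      inner ℝ (mfderiv 𝓘(ℝ, E) 𝓘(ℝ, E') F p v) (mfderiv 𝓘(ℝ, E) 𝓘(ℝ, E') F p u)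
        = inner ℝ v u := by
    intro u hu
    -- Polarization: preserved lengths give preserved inner products.
    rw [real_inner_eq_norm_add_mul_self_sub_norm_mul_self_sub_norm_mul_self_div_two,
      real_inner_eq_norm_add_mul_self_sub_norm_mul_self_sub_norm_mul_self_div_two, ← map_add,
      hF.norm_mfderiv p _ (add_mem hv hu), hF.norm_mfderiv p _ hv, hF.norm_mfderiv p _ hu]
  -- The vertical part of w is killed by dF and is orthogonal to v.
  obtain ⟨a, ha, b, hb, rfl⟩ := (vertical E E' F p).exists_add_mem_mem_orthogonal w
  have ha0 : mfderiv 𝓘(ℝ, E) 𝓘(ℝ, E') F p a = 0 := ha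
  rw [map_add, ha0, zero_add, inner_add_right, hhor b hb,
    Submodule.inner_left_of_mem_orthogonal ha hv, zero_add]

variable [IsManifold 𝓘(ℝ, E) ∞ M] [FiniteDimensional ℝ E'] [IsManifold 𝓘(ℝ, E') ∞ N]
  [IsContMDiffRiemannianBundle 𝓘(ℝ, E) ∞ E (fun p : M => TangentSpace 𝓘(ℝ, E) p)]
  [IsContMDiffRiemannianBundle 𝓘(ℝ, E') ∞ E' (fun p : N => TangentSpace 𝓘(ℝ, E') p)]
  {X Y Z : Π p : M, TangentSpace 𝓘(ℝ, E) p}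

/-- The Koszul expression of two horizontal fields and a field that is vertical at `p`. -/
theorem IsRiemannianSubmersion.koszul_eq (hF : IsRiemannianSubmersion E E' F)
    (hX : MDiffAt (T% X) p) (hY : MDiffAt (T% Y) p) (hZ : MDiffAt (T% Z) p)
    (hXh : ∀ q, X q ∈ horizontal E E' F q) (hYh : ∀ q, Y q ∈ horizontal E E' F q)
    (hZv : Z p ∈ vertical E E' F p) :
    koszul X Y Z p = inner ℝ (mlieBracket 𝓘(ℝ, E) X Y p) (Z p) := by
  have := FiniteDimensional.complete ℝ E
  obtain ⟨n, f, G, hf, hG, hsymm, hker, hev⟩ := exists_pullback_metric_coordinates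
    (E := E) (E' := E') (p := p) ((hF.smooth.of_le (n := ∞) (m := 2) (WithTop.coe_le_coe.2 (le_top (a := (2 : ℕ∞))))) p)
  -- One horizontal entry suffices; this allows W = Z, which need not be vertical away from p.
  have hinner : ∀ {U W : Π p : M, TangentSpace 𝓘(ℝ, E) p}, (∀ q, U q ∈ horizontal E E' F q) →
      metricFun U W =ᶠ[𝓝 p] fun q => ∑ i, ∑ j,
        mvfderiv 𝓘(ℝ, E) (f i) q (U q) * mvfderiv 𝓘(ℝ, E) (f j) q (W q) * G i j q := by
    intro U W hU
    filter_upwards [hev] with q hq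
    rw [← hq, hF.inner_mfderiv (hU q)]
    rfl
  have hd : ∀ {W : Π p : M, TangentSpace 𝓘(ℝ, E) p}, MDiffAt (T% W) p → ∀ i,
      MDiffAt (fun q => mvfderiv 𝓘(ℝ, E) (f i) q (W q)) p :=
    fun hW i => mdifferentiableAt_mvfderiv_apply (hf i) hW
  have hbr : ∀ {U W : Π p : M, TangentSpace 𝓘(ℝ, E) p}, MDiffAt (T% U) p → MDiffAt (T% W) p →
      (∀ q, W q ∈ horizontal E E' F q) →
      inner ℝ (mlieBracket 𝓘(ℝ, E) U Z p) (W p) = ∑ i, ∑ j, mvfderiv 𝓘(ℝ, E) (f i) p (W p) *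
        (mvfderiv 𝓘(ℝ, E) (fun q => mvfderiv 𝓘(ℝ, E) (f j) q (Z q)) p (U p) -
          mvfderiv 𝓘(ℝ, E) (fun q => mvfderiv 𝓘(ℝ, E) (f j) q (U q)) p (Z p)) * G i j p := by
    intro U W hU hW hWh
    rw [real_inner_comm, ← hF.inner_mfderiv (hWh p), hev.self_of_nhds]
    simp only [mvfderiv_mlieBracket (hf _) hU hZ]
  obtain ⟨hZ0, hG0⟩ := hker (Z p) hZv
  rw [koszul, metricFun_comm Z X,
    mvfderiv_sum_sum_mul_apply (hd hY) (hd hZ) hG (hinner hYh),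
    mvfderiv_sum_sum_mul_apply (hd hX) (hd hZ) hG (hinner hXh),
    mvfderiv_sum_sum_mul_apply (hd hX) (hd hY) hG (hinner hXh),
    hbr hX hY hYh, hbr hY hX hXh]
  -- The symmetry of G matches the term left by g([X, Z], Y) with one of the two in Z g(X, Y).
  have hswap : ∑ i, ∑ j, mvfderiv 𝓘(ℝ, E) (f i) p (Y p) *
        mvfderiv 𝓘(ℝ, E) (fun q => mvfderiv 𝓘(ℝ, E) (f j) q (X q)) p (Z p) * G i j p =
      ∑ i, ∑ j, mvfderiv 𝓘(ℝ, E) (fun q => mvfderiv 𝓘(ℝ, E) (f i) q (X q)) p (Z p) *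
        mvfderiv 𝓘(ℝ, E) (f j) p (Y p) * G i j p := by
    rw [Finset.sum_comm]
    refine Finset.sum_congr rfl fun i _ => Finset.sum_congr rfl fun j _ => ?_
    rw [hsymm j i]
    ring
  -- At p the factors Z f_i and Z G_ij vanish, but X(Z f_j) and Y(Z f_j) need not; these cancel
  -- against the same terms in the brackets [X, Z] and [Y, Z].
  simp only [hZ0, hG0, mul_zero, zero_mul, zero_add, add_zero, mul_sub, sub_mul,
    Finset.sum_sub_distrib, Finset.sum_add_distrib, hswap]
  ring

/-- O'Neill: `2 g(∇_X Y, U) = g([X, Y], U)` for horizontal fields `X`, `Y` and vertical `U`. -/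
theorem IsRiemannianSubmersion.inner_leviCivita_vertical (hF : IsRiemannianSubmersion E E' F)
    (hX : MDiffAt (T% X) p) (hY : MDiffAt (T% Y) p)
    (hXh : ∀ q, X q ∈ horizontal E E' F q) (hYh : ∀ q, Y q ∈ horizontal E E' F q)
    {u : TangentSpace 𝓘(ℝ, E) p} (hu : u ∈ vertical E E' F p) :
    inner ℝ (leviCivita E M Y p (X p)) u = 1 / 2 * inner ℝ (mlieBracket 𝓘(ℝ, E) X Y p) u := by
  have hZ := FiberBundle.mdifferentiableAt_extend (I := 𝓘(ℝ, E)) E u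
  have h1 := inner_leviCivita hX hY hZ
  rw [hF.koszul_eq hX hY hZ hXh hYh (by rwa [FiberBundle.extend_apply_self])] at h1
  rwa [FiberBundle.extend_apply_self] at h1

/-- O'Neill: `𝒱 ∇_X Y = ½ 𝒱 [X, Y]` for horizontal fields `X` and `Y`. -/
theorem IsRiemannianSubmersion.projV_leviCivita (hF : IsRiemannianSubmersion E E' F)
    (hX : MDiffAt (T% X) p) (hY : MDiffAt (T% Y) p)
    (hXh : ∀ q, X q ∈ horizontal E E' F q) (hYh : ∀ q, Y q ∈ horizontal E E' F q) :
    projV E E' F p (leviCivita E M Y p (X p)) =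
      (1 / 2 : ℝ) • projV E E' F p (mlieBracket 𝓘(ℝ, E) X Y p) := by
  rw [← map_smul]
  refine (sub_eq_zero.1 ?_)
  rw [← map_sub, projV, Submodule.starProjection_apply_eq_zero_iff, Submodule.mem_orthogonal']
  intro u hu
  rw [inner_sub_left, inner_smul_left, hF.inner_leviCivita_vertical hX hY hXh hYh hu]
  simp

/-- On horizontal fields, `𝒜_X Y = ½ 𝒱 [X, Y]`. -/
theorem IsRiemannianSubmersion.oneillA_eq (hF : IsRiemannianSubmersion E E' F)
    (hX : MDiffAt (T% X) p) (hY : MDiffAt (T% Y) p)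
    (hXh : ∀ q, X q ∈ horizontal E E' F q) (hYh : ∀ q, Y q ∈ horizontal E E' F q) :
    oneillA E E' F X Y p = (1 / 2 : ℝ) • projV E E' F p (mlieBracket 𝓘(ℝ, E) X Y p) := by
  -- Y has no vertical part, so the first summand of 𝒜 drops out.
  have hV : (fun q => projV E E' F q (Y q)) = 0 := by
    ext q
    exact (Submodule.starProjection_apply_eq_zero_iff _).2 (hYh q)
  have hH : ∀ {W : Π p : M, TangentSpace 𝓘(ℝ, E) p}, (∀ q, W q ∈ horizontal E E' F q) →
      (fun q => projH E E' F q (W q)) = W := fun hW =>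
    funext fun q => Submodule.starProjection_eq_self_iff.2 (hW q)
  rw [oneillA, hV, hH hYh, congrFun (hH hXh) p, hF.projV_leviCivita hX hY hXh hYh]
  simp

end ONeill

/-! ### Orthogonality to D₁ in terms of P and C. -/

section SlantDistribution

variable {E : Type*} [NormedAddCommGroup E] [NormedSpace ℝ E] [FiniteDimensional ℝ E]
  {M : Type*} [TopologicalSpace M] [ChartedSpace E M] [IsManifold 𝓘(ℝ, E) ∞ M]
  [RiemannianBundle (fun p : M => TangentSpace 𝓘(ℝ, E) p)]
  {E' : Type*} [NormedAddCommGroup E'] [NormedSpace ℝ E']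
  {N : Type*} [TopologicalSpace N] [ChartedSpace E' N]
  {J : Π p : M, TangentSpace 𝓘(ℝ, E) p →L[ℝ] TangentSpace 𝓘(ℝ, E) p}
  {F : M → N} {D₁ : Π p : M, Submodule ℝ (TangentSpace 𝓘(ℝ, E) p)} {p : M}

/-- `P C v` vanishes exactly when `v` is orthogonal to the `J`-invariant distribution `D₁`. -/
theorem projD_opC_eq_zero_iff (hJ : IsAlmostHermitian J) (hle : D₁ p ≤ horizontal E E' F p)
    (hmap : (D₁ p).map (J p).toLinearMap = D₁ p) (v : TangentSpace 𝓘(ℝ, E) p) :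
    projD E D₁ p (opC E E' J F p v) = 0 ↔ v ∈ (D₁ p)ᗮ := by
  rw [projD, Submodule.starProjection_apply_eq_zero_iff, Submodule.mem_orthogonal,
    Submodule.mem_orthogonal]
  -- The projection ℋ is self-adjoint and fixes u, since D₁ is horizontal.
  have hC : ∀ u ∈ D₁ p, inner ℝ u (opC E E' J F p v) = inner ℝ u (J p v) := by
    intro u hu
    rw [opC, projH, ← Submodule.inner_starProjection_left_eq_right,
      Submodule.starProjection_eq_self_iff.2 (hle hu)]
  constructor
  · intro h u hu
    -- Testing against Ju gives g(Ju, Jv) = g(u, v); conversely, every u in D₁ is some Jw with w in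
    -- D₁.
    have hJu : J p u ∈ D₁ p := hmap ▸ Submodule.mem_map_of_mem hu
    rw [← hJ.inner_eq, ← hC _ hJu]
    exact h _ hJu
  · intro h u hu
    rw [hC u hu]
    obtain ⟨w, hw, rfl⟩ := hmap.symm ▸ hu
    exact (hJ.inner_eq p w v).trans (h w hw)

end SlantDistribution

end RiemSubmersion

/-! ### The integrability criterion. -/

theorem theorem3p4
    {E : Type*} [NormedAddCommGroup E] [NormedSpace ℝ E] [FiniteDimensional ℝ E]
    {M : Type*} [TopologicalSpace M] [T2Space M] [ChartedSpace E M] [IsManifold 𝓘(ℝ, E) ∞ M]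
    [RiemannianBundle (fun p : M => TangentSpace 𝓘(ℝ, E) p)]
    [IsContMDiffRiemannianBundle 𝓘(ℝ, E) ∞ E (fun p : M => TangentSpace 𝓘(ℝ, E) p)]
    {E' : Type*} [NormedAddCommGroup E'] [NormedSpace ℝ E'] [FiniteDimensional ℝ E']
    {N : Type*} [TopologicalSpace N] [T2Space N] [ChartedSpace E' N] [IsManifold 𝓘(ℝ, E') ∞ N]
    [RiemannianBundle (fun p : N => TangentSpace 𝓘(ℝ, E') p)]
    [IsContMDiffRiemannianBundle 𝓘(ℝ, E') ∞ E' (fun p : N => TangentSpace 𝓘(ℝ, E') p)]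
    (J : Π p : M, TangentSpace 𝓘(ℝ, E) p →L[ℝ] TangentSpace 𝓘(ℝ, E) p)
    (hJ : RiemSubmersion.IsAlmostHermitian J)
    (F : M → N) (D₁ : Π p : M, Submodule ℝ (TangentSpace 𝓘(ℝ, E) p)) (θ : ℝ)
    (hF : RiemSubmersion.IsVSemiSlantSubmersion E E' J F D₁ θ) :
    RiemSubmersion.IsIntegrable (RiemSubmersion.slantDistribution E E' F D₁) ↔
      ∀ X Y : Π p : M, TangentSpace 𝓘(ℝ, E) p,
        RiemSubmersion.IsSection (RiemSubmersion.slantDistribution E E' F D₁) X →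
        RiemSubmersion.IsSection (RiemSubmersion.slantDistribution E E' F D₁) Y →
        ∀ p : M,
          RiemSubmersion.oneillA E E' F X Y p = 0 ∧
          RiemSubmersion.projD E D₁ p (RiemSubmersion.opC E E' J F p
            (RiemSubmersion.leviCivita E M Y p (X p)
              - RiemSubmersion.leviCivita E M X p (Y p))) = 0 := by
  have hMD : ∀ {X : Π p : M, TangentSpace 𝓘(ℝ, E) p},
      RiemSubmersion.IsSection (RiemSubmersion.slantDistribution E E' F D₁) X →
      ∀ p, MDiffAt (T% X) p := fun hX p =>
    (contMDiffOn_univ.1 hX.1 p).mdifferentiableAt (by simp)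
  have hhor : ∀ {X : Π p : M, TangentSpace 𝓘(ℝ, E) p},
      RiemSubmersion.IsSection (RiemSubmersion.slantDistribution E E' F D₁) X →
      ∀ p, X p ∈ RiemSubmersion.horizontal E E' F p := fun hX p => (hX.2 p).2
  refine forall₄_congr fun X Y hX hY => forall_congr' fun p => ?_
  rw [hF.toIsRiemannianSubmersion.oneillA_eq (hMD hX p) (hMD hY p) (hhor hX) (hhor hY),
    RiemSubmersion.leviCivita_torsion_free (hMD hX p) (hMD hY p),
    RiemSubmersion.projD_opC_eq_zero_iff hJ (hF.le_horizontal p) (hF.map_eq p),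
    smul_eq_zero_iff_right (by norm_num), RiemSubmersion.projV,
    Submodule.starProjection_apply_eq_zero_iff]
  -- Membership in D₂ unfolds to orthogonality to D₁ and to the vertical space, the same two
  -- conditions in the other order.
  exact and_comm
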